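/- Let $q\ge 0$, $\mathcal H=\mathbb R^\infty\times\mathbb R^q$ with points $x=(z,\theta)$, and let $\Phi:\mathcal H\to\mathbb R$ be measurable with partial derivatives in all coordinates everywhere; write $\nabla\Phi=(\nabla_z\Phi,\nabla_\theta\Phi)$ for the vector of these. Let $\mu_0=\big(\prod_{i=1}^\infty N(0,1)\big)\otimes \mathrm{Leb}_q$, assume $Z=\int e^{-\Phi}\,d\mu_0<\infty$, and let $\Pi$ be the probability measure $d\Pi/d\mu_0=Z^{-1}e^{-\Phi}$. Let $A=\mathrm{diag}(a_1,\dots,a_q)$ with all $a_i>0$, $M=\mathrm{diag}(I_\infty,A)$, $N(0,M^{-1})=\prod_{i=1}^\infty N(0,1)\otimes N_q(0,A^{-1})$ on velocities $v=(v_z,v_\theta)\in\mathcal H$, and put $Q=\Pi\otimes N(0,M^{-1})$, $Q_0=\mu_0\otimes N(0,M^{-1})$. For $h>0$ define $$\Xi_t(x,v)=(x,\,v-tM^{-1}\nabla\Phi(x)),$$ $$\tilde\Xi_t(x,v)=\big((\cos(t)z+\sin(t)v_z,\ \theta+tv_\theta),\ (-\sin(t)z+\cos(t)v_z,\ v_\theta)\big),$$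 $\Psi_h=\Xi_{h/2}\circ\tilde\Xi_h\circ\Xi_{h/2}$, and for an integer $I\ge0$ write $(x_I,v_I)=\Psi_h^I(x_0,v_0)$ and $Q^{(I)}=Q\circ(\Psi_h^{I})^{-1}$ for the push-forward of $Q$ under $\Psi_h^I$. Let $$\Delta H(x_0,v_0)=\lim_{n\to\infty}\{H_n(x_I,v_I)-H_n(x_0,v_0)\},\qquad H_n(x,v)=\Phi(x)+\tfrac12\sum_{j\le n}z_j^2+\tfrac12\sum_{j\le n}v_{z,j}^2+\tfrac12\langle v_\theta,Av_\theta\rangle$$ (with an arbitrary fixed value where the limit does not exist), and $a(x_0,v_0)=1\wedge\exp\{-\Delta H(x_0,v_0)\}$. Let $p$ be a strictly positive measurable prior density on $\mathbb R^q$, and assume that $\nabla_z\Phi(z,\theta)\in\ell_2$ almost surely under $\prod_{i=1}^\infty N(0,1)\otimes p(\theta)d\theta$. Then the limit defining $\Delta H$ exists and is finite $Q_0$-almost everywhere, and: (i) $Q^{(I)}$ is absolutely continuous with respect to $Q_0$, with probability density given by $$\frac{dQ^{(I)}}{dQ_0}(x_I,v_I)=Z^{-1}\exp\{\Delta H(x_0,v_0)-\Phi(x_I)\}.$$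 (ii) The Markov chain on $\mathcal H$ with transition, from the current position $x_0$, $$x'=\mathrm I\{U\le a(x_0,v_0)\}\,x_I+\mathrm I\{U>a(x_0,v_0)\}\,x_0,$$ for independent $U\sim\mathrm{Un}[0,1]$ and $v_0\sim N(0,M^{-1})$, has $\Pi$ as an invariant distribution. -/

import Mathlib

open MeasureTheory ProbabilityTheory Filter Topology

noncomputable section

namespace AdvHMC

/-- The location space `ℝ^∞ × ℝ^q`; a point is `x = (z, θ)`. Velocities `v = (v_z, v_θ)` live in the
same space. It carries the product topology and the product σ-algebra. -/
abbrev State (q : ℕ) : Type := (ℕ → ℝ) × (Fin q → ℝ)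

variable {q : ℕ}

/-- The infinite product `∏_{i=1}^∞ N(0,1)` on `ℝ^∞`. -/
def stdGaussianSeq : Measure (ℕ → ℝ) :=
  Measure.infinitePi (fun _ : ℕ => gaussianReal 0 1)

/-- The reference measure `∏ N(0,1) ⊗ Leb_q` on the location space. -/
def refMeasure (q : ℕ) : Measure (State q) :=
  stdGaussianSeq.prod (volume : Measure (Fin q → ℝ))

/-- The measure `∏ N(0,1) ⊗ p(dθ)`, where `p` is a density with respect to `Leb_q`. -/
def priorMeasure (p : (Fin q → ℝ) → ℝ) : Measure (State q) :=
  stdGaussianSeq.prod ((volume : Measure (Fin q → ℝ)).withDensity fun θ => ENNReal.ofReal (p θ))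

/-- The velocity law `N(0, M⁻¹) = ∏ N(0,1) ⊗ N_q(0, A⁻¹)`, where `M = diag(I_∞, A)` and
`A = diag(a₁, …, a_q)`. -/
def velocityLaw (a : Fin q → ℝ) : Measure (State q) :=
  stdGaussianSeq.prod (Measure.pi fun i => gaussianReal 0 (a i)⁻¹.toNNReal)

/-- The normalising constant of the density `exp (-Φ)`. -/
def normConst (Φ : State q → ℝ) : ENNReal :=
  ∫⁻ x, ENNReal.ofReal (Real.exp (-Φ x)) ∂(refMeasure q)

/-- The target `Π`, with `dΠ / d(∏ N(0,1) ⊗ Leb_q) ∝ exp (-Φ)`. -/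
def target (Φ : State q → ℝ) : Measure (State q) :=
  (normConst Φ)⁻¹ • (refMeasure q).withDensity fun x => ENNReal.ofReal (Real.exp (-Φ x))

/-- The joint location/velocity law `Q = Π ⊗ N(0, M⁻¹)`. -/
def jointTarget (Φ : State q → ℝ) (a : Fin q → ℝ) : Measure (State q × State q) :=
  (target Φ).prod (velocityLaw a)

/-- The reference measure `Q₀ = {∏ N(0,1) ⊗ Leb_q} ⊗ N(0, M⁻¹)` on location/velocity space. -/
def jointRef (a : Fin q → ℝ) : Measure (State q × State q) :=
  (refMeasure q).prod (velocityLaw a)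

/-- `Φ` has a partial derivative in every coordinate of `z` and of `θ`, at every point. -/
def HasPartials (Φ : State q → ℝ) : Prop :=
  ∀ x : State q,
    (∀ j : ℕ, DifferentiableAt ℝ (fun s : ℝ => Φ (Function.update x.1 j s, x.2)) (x.1 j)) ∧
    (∀ i : Fin q, DifferentiableAt ℝ (fun s : ℝ => Φ (x.1, Function.update x.2 i s)) (x.2 i))

/-- `∇_z Φ`, the vector of partial derivatives over the `z`-component. -/
def gradZ (Φ : State q → ℝ) (x : State q) : ℕ → ℝ :=
  fun j => deriv (fun s : ℝ => Φ (Function.update x.1 j s, x.2)) (x.1 j)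

/-- `∇_θ Φ`, the vector of partial derivatives over the `θ`-component. -/
def gradTheta (Φ : State q → ℝ) (x : State q) : Fin q → ℝ :=
  fun i => deriv (fun s : ℝ => Φ (x.1, Function.update x.2 i s)) (x.2 i)

/-- `∇ Φ = (∇_z Φ, ∇_θ Φ)`. -/
def grad (Φ : State q → ℝ) (x : State q) : State q := (gradZ Φ x, gradTheta Φ x)

/-- The action of `M⁻¹ = diag(I_∞, A⁻¹)`. -/
def massInv (a : Fin q → ℝ) (w : State q) : State q := (w.1, fun i => (a i)⁻¹ * w.2 i)

/-- The gradient kick `Ξ_t (x, v) = (x, v - t M⁻¹ ∇Φ(x))`. -/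
def kick (Φ : State q → ℝ) (a : Fin q → ℝ) (t : ℝ) (w : State q × State q) :
    State q × State q :=
  (w.1, w.2 - t • massInv a (grad Φ w.1))

/-- The exact flow of `dx/dt = v`, `dv/dt = -(z, 0)`: a rotation in `(z, v_z)` and a free motion
in `θ`. -/
def drift (t : ℝ) (w : State q × State q) : State q × State q :=
  ((Real.cos t • w.1.1 + Real.sin t • w.2.1, w.1.2 + t • w.2.2),
    (-Real.sin t • w.1.1 + Real.cos t • w.2.1, w.2.2))

/-- The modified leapfrog map `Ψ_h`. -/
def leapfrog (Φ : State q → ℝ) (a : Fin q → ℝ) (h : ℝ) : State q × State q → State q × State q :=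
  kick Φ a (h / 2) ∘ drift h ∘ kick Φ a (h / 2)

/-- The synthesis `Ψ_h^I` of `I` leapfrog steps. -/
def trajectory (Φ : State q → ℝ) (a : Fin q → ℝ) (h : ℝ) (I : ℕ) :
    State q × State q → State q × State q :=
  (leapfrog Φ a h)^[I]

/-- The energy `H(x, v; M) = Φ(x) + ⟨z, z⟩/2 + ⟨v, M v⟩/2`, in which the inner products over
`ℝ^∞` are restricted to the first `n` coordinates. -/
def truncEnergy (Φ : State q → ℝ) (a : Fin q → ℝ) (n : ℕ) (w : State q × State q) : ℝ :=
  Φ w.1 + (1 / 2) * ∑ j ∈ Finset.range n, w.1.1 j ^ 2 +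
    (1 / 2) * (∑ j ∈ Finset.range n, w.2.1 j ^ 2 + ∑ i, a i * w.2.2 i ^ 2)

/-- The difference `H(x_I, v_I; M) - H(x₀, v₀; M)` of the energies restricted to the first `n`
coordinates, with `(x_I, v_I) = Ψ_h^I (x₀, v₀)`. -/
def truncDeltaH (Φ : State q → ℝ) (a : Fin q → ℝ) (h : ℝ) (I n : ℕ) (w : State q × State q) : ℝ :=
  truncEnergy Φ a n (trajectory Φ a h I w) - truncEnergy Φ a n w

/-- The energy difference `ΔH(x₀, v₀) = H(x_I, v_I; M) - H(x₀, v₀; M)`. Both energies are infinite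
almost surely, so the difference is the limit over the number of coordinates that are kept
(with an arbitrary value where this limit does not exist). -/
def deltaH (Φ : State q → ℝ) (a : Fin q → ℝ) (h : ℝ) (I : ℕ) (w : State q × State q) : ℝ :=
  limUnder atTop fun n : ℕ => truncDeltaH Φ a h I n w

/-- The acceptance probability `a(x₀, v₀) = 1 ∧ exp (-ΔH(x₀, v₀))`. -/
def acceptProb (Φ : State q → ℝ) (a : Fin q → ℝ) (h : ℝ) (I : ℕ) (w : State q × State q) : ℝ :=
  min 1 (Real.exp (-deltaH Φ a h I w))

/-- The update `x' = 𝟙{U ≤ a(x₀, v₀)} x_I + 𝟙{U > a(x₀, v₀)} x₀`, as a function of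
`(x₀, (v₀, U))`. -/
def update (Φ : State q → ℝ) (a : Fin q → ℝ) (h : ℝ) (I : ℕ) (s : State q × (State q × ℝ)) :
    State q :=
  if s.2.2 ≤ acceptProb Φ a h I (s.1, s.2.1) then (trajectory Φ a h I (s.1, s.2.1)).1 else s.1

/-- The transition kernel of the chain: the law of `x'` given `x₀`, for independent
`v₀ ∼ N(0, M⁻¹)` and `U ∼ Un[0,1]`. -/
def chain (Φ : State q → ℝ) (a : Fin q → ℝ) (h : ℝ) (I : ℕ) : Kernel (State q) (State q) :=
  (Kernel.id ×ₖ Kernel.const (State q)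
    ((velocityLaw a).prod ((volume : Measure ℝ).restrict (Set.Icc 0 1)))).map (update Φ a h I)

end AdvHMC

end

noncomputable section

namespace AdvHMC

/-! Every factor of the leapfrog map changes the energy without potential by some δ, and carries the
reference law weighted by exp(-δ) back to the reference law (`IsEnergyShift`). This property
survives composition (`IsEnergyShift.comp`), so it suffices to have it for the factors. For the
drift, δ = 0: rotations preserve a pair of independent standard Gaussians, the shear in θ preserves
Lebesgue measure, and no energy is exchanged between different coordinates. For the kick, x is fixed
and the velocity is translated by a vector whose z-part is square summable for almost every x; the
Cameron–Martin theorem `stdGaussianSeq_withDensity_shift_map` supplies the density, a martingale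
argument supplies the limit δ, and Fubini over x gives `isEnergyShift_kick`.

For the whole trajectory T, almost everywhere ΔH = Φ(x_I) - Φ(x₀) + δ. Hence exp(-Φ(x₀)) = exp(-δ)
exp(ΔH - Φ(x_I)), and the change of variables by T yields the density in (i). For (ii), let S be the
velocity flip. Since T S T = S, the map S ∘ T is an involution, and it reverses the sign of ΔH. This
gives the detailed balance identity `lintegral_acceptProb_mul_trajectory`; the flip leaves no trace
because only the location is kept. -/

/-! ### Integration and product measures -/

theorem lintegral_infinitePi_prod {ι : Type*} {X : ι → Type*} [∀ i, MeasurableSpace (X i)]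
    (μ : ∀ i, Measure (X i)) [∀ i, IsProbabilityMeasure (μ i)] (S : Finset ι)
    {f : ∀ i, X i → ENNReal} (hf : ∀ i, Measurable (f i)) :
    ∫⁻ x, ∏ i ∈ S, f i (x i) ∂(Measure.infinitePi μ) = ∏ i ∈ S, ∫⁻ y, f i y ∂(μ i) := by
  have h := lintegral_prod_eq_prod_lintegral_of_indepFun (μ := Measure.infinitePi μ) S
    (fun i x => f i (x i)) (iIndepFun_infinitePi hf) (fun i => by fun_prop)
  rw [h]
  refine Finset.prod_congr rfl fun i _ => ?_
  rw [← (measurePreserving_eval_infinitePi μ i).lintegral_comp (hf i)]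

/-- Bounded second moments give uniform integrability. Fatou bounds the limit inferior from below;
for the limit superior, truncate at height K, use dominated convergence on the truncated part, and
let K → ∞ in the error C / K. -/
theorem tendsto_lintegral_of_lintegral_sq_le {Ω : Type*} [MeasurableSpace Ω] {μ : Measure Ω}
    [IsFiniteMeasure μ] {f : ℕ → Ω → ENNReal} {g : Ω → ENNReal} (hf : ∀ n, Measurable (f n))
    (hfg : ∀ᵐ ω ∂μ, Tendsto (fun n => f n ω) atTop (𝓝 (g ω)))
    {C : ENNReal} (hC : C ≠ ⊤) (hfC : ∀ n, ∫⁻ ω, f n ω ^ 2 ∂μ ≤ C) :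
    Tendsto (fun n => ∫⁻ ω, f n ω ∂μ) atTop (𝓝 (∫⁻ ω, g ω ∂μ)) := by
  have hlow : ∫⁻ ω, g ω ∂μ ≤ liminf (fun n => ∫⁻ ω, f n ω ∂μ) atTop := by
    rw [lintegral_congr_ae (g := fun ω => liminf (fun n => f n ω) atTop)
      (hfg.mono fun ω h => h.liminf_eq.symm)]
    exact lintegral_liminf_le hf
  have hup (K : ℕ) (hK : K ≠ 0) :
      limsup (fun n => ∫⁻ ω, f n ω ∂μ) atTop ≤ ∫⁻ ω, g ω ∂μ + (K : ENNReal)⁻¹ * C := by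
    have hK0 : (K : ENNReal) ≠ 0 := by exact_mod_cast hK
    have hKt : (K : ENNReal) ≠ ⊤ := ENNReal.natCast_ne_top K
    -- Where f exceeds K, f ≤ f² / K.
    have hpt (n : ℕ) (ω : Ω) : f n ω ≤ min (f n ω) K + (K : ENNReal)⁻¹ * f n ω ^ 2 := by
      rcases le_total (f n ω) K with h | h
      · rw [min_eq_left h]; exact le_self_add
      · refine le_add_left ?_
        calc f n ω = (K : ENNReal)⁻¹ * (K * f n ω) := by
              rw [← mul_assoc, ENNReal.inv_mul_cancel hK0 hKt, one_mul]
          _ ≤ _ := by rw [sq]; gcongr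
    have hint (n : ℕ) : ∫⁻ ω, f n ω ∂μ ≤
        ∫⁻ ω, min (f n ω) K ∂μ + (K : ENNReal)⁻¹ * C := by
      calc ∫⁻ ω, f n ω ∂μ ≤ ∫⁻ ω, (min (f n ω) K + (K : ENNReal)⁻¹ * f n ω ^ 2) ∂μ :=
            lintegral_mono (hpt n)
        _ = ∫⁻ ω, min (f n ω) K ∂μ + (K : ENNReal)⁻¹ * ∫⁻ ω, f n ω ^ 2 ∂μ := by
            rw [lintegral_add_left ((hf n).min measurable_const),
              lintegral_const_mul _ ((hf n).pow_const 2)]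
        _ ≤ _ := by gcongr; exact hfC n
    have hlim : Tendsto (fun n => ∫⁻ ω, min (f n ω) K ∂μ) atTop
        (𝓝 (∫⁻ ω, min (g ω) K ∂μ)) := by
      refine tendsto_lintegral_of_dominated_convergence (fun _ => (K : ENNReal))
        (fun n => (hf n).min measurable_const) (fun n => ae_of_all _ fun ω => min_le_right _ _)
        ?_ (hfg.mono fun ω h => h.min tendsto_const_nhds)
      rw [lintegral_const]
      exact ENNReal.mul_ne_top hKt (measure_ne_top _ _)
    calc limsup (fun n => ∫⁻ ω, f n ω ∂μ) atTop
        ≤ limsup (fun n => ∫⁻ ω, min (f n ω) K ∂μ + (K : ENNReal)⁻¹ * C) atTop :=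
          limsup_le_limsup (Eventually.of_forall hint)
      _ = ∫⁻ ω, min (g ω) K ∂μ + (K : ENNReal)⁻¹ * C :=
          (hlim.add tendsto_const_nhds).limsup_eq
      _ ≤ _ := by gcongr; exact min_le_left _ _
  refine tendsto_of_le_liminf_of_limsup_le hlow ?_
  have hK : Tendsto (fun K : ℕ => ∫⁻ ω, g ω ∂μ + (K : ENNReal)⁻¹ * C) atTop
      (𝓝 (∫⁻ ω, g ω ∂μ + 0 * C)) :=
    tendsto_const_nhds.add
      (ENNReal.Tendsto.mul_const ENNReal.tendsto_inv_nat_nhds_zero (Or.inr hC))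
  rw [zero_mul, add_zero] at hK
  exact ge_of_tendsto hK ((eventually_ne_atTop 0).mono hup)

theorem pi_eq_pi_ite_of_subset {ι : Type*} {X : ι → Type*} [DecidableEq ι] {s u : Finset ι}
    (hsu : s ⊆ u) (t : ∀ i, Set (X i)) :
    (s : Set ι).pi t = (u : Set ι).pi fun i => if i ∈ s then t i else Set.univ := by
  ext x
  simp only [Set.mem_pi, Finset.mem_coe]
  refine ⟨fun h i _ => ?_, fun h i hi => ?_⟩
  · split_ifs with hi
    exacts [h i hi, trivial]
  · simpa [hi] using h i (hsu hi)

theorem measurableSet_ite_univ {ι : Type*} {X : ι → Type*} [DecidableEq ι]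
    [∀ i, MeasurableSpace (X i)] (s : Finset ι) {t : ∀ i, Set (X i)}
    (ht : ∀ i, MeasurableSet (t i)) (i : ι) :
    MeasurableSet (if i ∈ s then t i else Set.univ) := by
  split_ifs
  exacts [ht i, .univ]

/-- The whole space spans a finite measure on a product, as a square cylinder over no index. -/
def finiteSpanningSetsInSquareCylinders {ι : Type*} {X : ι → Type*} [∀ i, MeasurableSpace (X i)]
    (κ : Measure (∀ i, X i)) [IsFiniteMeasure κ] :
    κ.FiniteSpanningSetsIn (squareCylinders fun i => {s : Set (X i) | MeasurableSet s}) where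
  set := fun _ => Set.univ
  set_mem := fun _ => ⟨∅, fun _ => Set.univ, fun _ _ => .univ, by simp⟩
  finite := fun _ => measure_lt_top _ _
  spanning := Set.iUnion_const _

/-- Products of two square cylinders form a generating π-system. On such a product, padding both
cylinders with whole spaces to the common index set s ∪ s' makes the two sides the same finite
product. It lets a rotation be applied pair by pair. -/
theorem infinitePi_prod_map_unzip {ι : Type*} {X Y : ι → Type*} [∀ i, MeasurableSpace (X i)]
    [∀ i, MeasurableSpace (Y i)] (μ : ∀ i, Measure (X i)) [∀ i, IsProbabilityMeasure (μ i)]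
    (ν : ∀ i, Measure (Y i)) [∀ i, IsProbabilityMeasure (ν i)] :
    (Measure.infinitePi fun i => (μ i).prod (ν i)).map
        (fun x => (fun i => (x i).1, fun i => (x i).2)) =
      (Measure.infinitePi μ).prod (Measure.infinitePi ν) := by
  classical
  refine (Measure.prod_eq_generateFrom generateFrom_squareCylinders generateFrom_squareCylinders
    (isPiSystem_squareCylinders (fun _ => MeasurableSpace.isPiSystem_measurableSet)
      fun _ => .univ)
    (isPiSystem_squareCylinders (fun _ => MeasurableSpace.isPiSystem_measurableSet)
      fun _ => .univ) 
    (finiteSpanningSetsInSquareCylinders _) (finiteSpanningSetsInSquareCylinders _) ?_).symm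
  rintro _ ⟨s, t, ht, rfl⟩ _ ⟨s', t', ht', rfl⟩
  replace ht : ∀ i, MeasurableSet (t i) := fun i => ht i trivial
  replace ht' : ∀ i, MeasurableSet (t' i) := fun i => ht' i trivial
  rw [pi_eq_pi_ite_of_subset (Finset.subset_union_left (s₂ := s')) t,
    pi_eq_pi_ite_of_subset (Finset.subset_union_right (s₁ := s)) t',
    Measure.infinitePi_pi _ fun i _ => measurableSet_ite_univ s ht i,
    Measure.infinitePi_pi _ fun i _ => measurableSet_ite_univ s' ht' i, ← Finset.prod_mul_distrib,
    Measure.map_apply (by fun_prop)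
      ((MeasurableSet.pi (Finset.countable_toSet _) fun i _ => measurableSet_ite_univ s ht i).prod
      (MeasurableSet.pi (Finset.countable_toSet _) fun i _ => measurableSet_ite_univ s' ht' i))]
  simp_rw [← Measure.prod_prod]
  rw [← Measure.infinitePi_pi _ fun i _ =>
    (measurableSet_ite_univ s ht i).prod (measurableSet_ite_univ s' ht' i)]
  congr 1
  ext x
  simp only [Set.mem_preimage, Set.mem_prod, Set.mem_pi]
  exact ⟨fun h i hi => ⟨h.1 i hi, h.2 i hi⟩,
    fun h => ⟨fun i hi => (h i hi).1, fun i hi => (h i hi).2⟩⟩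

/-- The derivative is the limit of difference quotients along 1 / (n + 1). The base point moves with
x, so only measurability along the translates t x + r is needed. -/
theorem measurable_deriv_of_differentiableAt {α : Type*} [MeasurableSpace α] {F : α → ℝ → ℝ}
    {t : α → ℝ} (hF : ∀ r, Measurable fun x => F x (t x + r))
    (hd : ∀ x, DifferentiableAt ℝ (F x) (t x)) : Measurable fun x => deriv (F x) (t x) := by
  have hu : Tendsto (fun n : ℕ => (1 : ℝ) / (n + 1)) atTop (𝓝[≠] 0) :=
    tendsto_nhdsWithin_iff.2 ⟨tendsto_one_div_add_atTop_nhds_zero_nat,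
      Eventually.of_forall fun n => (Nat.one_div_pos_of_nat (n := n)).ne'⟩
  refine measurable_of_tendsto_metrizable
    (f := fun (n : ℕ) x => ((1 : ℝ) / (n + 1))⁻¹ • (F x (t x + 1 / (n + 1)) - F x (t x)))
    (fun n => ?_) (tendsto_pi_nhds.2 fun x => (hd x).hasDerivAt.tendsto_slope_zero.comp hu)
  have h0 := hF 0
  simp only [add_zero] at h0
  exact ((hF _).sub h0).const_smul ((1 : ℝ) / (n + 1))⁻¹

theorem measurable_limUnder {α : Type*} [MeasurableSpace α] {f : ℕ → α → ℝ}
    (hf : ∀ n, Measurable (f n)) : Measurable fun x => limUnder atTop fun n => f n x :=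
  (StronglyMeasurable.limUnder fun n => (hf n).stronglyMeasurable).measurable

/-! ### Gaussian shifts and Cameron–Martin -/

/-- The density at `x` that a shift by `c` compensates under the law `N(0, v)`. -/
def shiftDensity (v : NNReal) (c x : ℝ) : ENNReal :=
  ENNReal.ofReal (Real.exp (-((2 * v : ℝ)⁻¹ * ((x + c) ^ 2 - x ^ 2))))

@[fun_prop]
theorem measurable_shiftDensity (v : NNReal) (c : ℝ) : Measurable (shiftDensity v c) := by
  unfold shiftDensity; fun_prop

theorem prod_shiftDensity {ι : Type*} (S : Finset ι) (v : ι → NNReal) (c x : ι → ℝ) :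
    ∏ i ∈ S, shiftDensity (v i) (c i) (x i) =
      ENNReal.ofReal (Real.exp (-∑ i ∈ S, (2 * v i : ℝ)⁻¹ * ((x i + c i) ^ 2 - x i ^ 2))) := by
  simp only [shiftDensity]
  rw [← ENNReal.ofReal_prod_of_nonneg fun i _ => (Real.exp_pos _).le, ← Real.exp_sum,
    Finset.sum_neg_distrib]

/-- Completing the square, the tilt turns N(0, v) into N(-c, v), which the shift recentres. -/
theorem gaussianReal_withDensity_shiftDensity_map {v : NNReal} (hv : v ≠ 0) (c : ℝ) :
    ((gaussianReal 0 v).withDensity (shiftDensity v c)).map (· + c) = gaussianReal 0 v := by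
  have : (gaussianReal 0 v).withDensity (shiftDensity v c) = gaussianReal (-c) v := by
    rw [gaussianReal_of_var_ne_zero _ hv, gaussianReal_of_var_ne_zero _ hv,
      ← withDensity_mul _ (measurable_gaussianPDF _ _) (measurable_shiftDensity v c)]
    congr 1
    ext x
    simp only [Pi.mul_apply, gaussianPDF, shiftDensity, gaussianPDFReal]
    rw [← ENNReal.ofReal_mul (by positivity), mul_assoc, ← Real.exp_add]
    congr 3
    have : (v : ℝ) ≠ 0 := by exact_mod_cast hv
    field_simp
    ring_nf
  rw [this, gaussianReal_map_add_const, neg_add_cancel]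

/-- The integral factorises over S, and an index of S outside s contributes the total mass 1. The
value therefore does not depend on S, which is what allows S to grow. -/
theorem setLIntegral_infinitePi_prod_shift {ι : Type*} (μ : ι → Measure ℝ)
    [∀ i, IsProbabilityMeasure (μ i)] {f : ι → ℝ → ENNReal} (hf : ∀ i, Measurable (f i))
    {c : ι → ℝ} (hμ : ∀ i, ((μ i).withDensity (f i)).map (· + c i) = μ i)
    {s S : Finset ι} (hsS : s ⊆ S) {t : ι → Set ℝ} (ht : ∀ i, MeasurableSet (t i)) :
    ∫⁻ x in (· + c) ⁻¹' (s : Set ι).pi t, ∏ i ∈ S, f i (x i) ∂(Measure.infinitePi μ) =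
      ∏ i ∈ s, μ i (t i) := by
  classical
  have hm (i : ι) := measurableSet_ite_univ s ht i
  have hp (i : ι) : MeasurableSet ((· + c i) ⁻¹' if i ∈ s then t i else Set.univ) :=
    (hm i).preimage (by fun_prop)
  rw [← Measure.infinitePi_pi μ fun i _ => ht i, pi_eq_pi_ite_of_subset hsS t,
    Measure.infinitePi_pi μ fun i _ => hm i, ← lintegral_indicator
      ((MeasurableSet.pi (Finset.countable_toSet S) fun i _ => hm i).preimage
        (measurable_pi_iff.2 fun i => by simp only [Pi.add_apply]; fun_prop))]
  calc _ = ∫⁻ x, ∏ i ∈ S, ((· + c i) ⁻¹' if i ∈ s then t i else Set.univ).indicator (f i) (x i)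
          ∂(Measure.infinitePi μ) := by
        refine lintegral_congr fun x => ?_
        by_cases hx : ∀ i ∈ S, x i + c i ∈ if i ∈ s then t i else Set.univ
        · rw [Set.indicator_of_mem (by simpa [Set.mem_pi] using hx)]
          exact Finset.prod_congr rfl fun i hi =>
            (Set.indicator_of_mem (s := (· + c i) ⁻¹' _) (hx i hi) (f i)).symm
        · rw [Set.indicator_of_notMem fun h => hx (by simpa [Set.mem_pi] using h)]
          push Not at hx
          obtain ⟨i, hi, hxi⟩ := hx
          exact (Finset.prod_eq_zero hi
            (Set.indicator_of_notMem (s := (· + c i) ⁻¹' _) hxi (f i))).symm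
    _ = _ := by
        rw [lintegral_infinitePi_prod μ S fun i => (hf i).indicator (hp i)]
        refine Finset.prod_congr rfl fun i _ => ?_
        rw [lintegral_indicator (hp i), ← withDensity_apply _ (hp i),
          ← Measure.map_apply (by fun_prop) (hm i), hμ i]

theorem pi_withDensity_prod_shift_map {ι : Type*} [Fintype ι] (μ : ι → Measure ℝ)
    [∀ i, IsProbabilityMeasure (μ i)] {f : ι → ℝ → ENNReal} (hf : ∀ i, Measurable (f i))
    {c : ι → ℝ} (hμ : ∀ i, ((μ i).withDensity (f i)).map (· + c i) = μ i) :
    ((Measure.pi μ).withDensity fun x => ∏ i, f i (x i)).map (· + c) = Measure.pi μ := by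
  rw [← Measure.infinitePi_eq_pi]
  refine Measure.eq_infinitePi μ fun s t ht => ?_
  have hm : MeasurableSet ((s : Set ι).pi t) :=
    MeasurableSet.pi (Finset.countable_toSet s) fun i _ => ht i
  rw [Measure.map_apply (by fun_prop) hm, withDensity_apply _ (hm.preimage (by fun_prop)),
    setLIntegral_infinitePi_prod_shift μ hf hμ (Finset.subset_univ s) ht]

theorem lintegral_exp_mul_gaussianReal (c : ℝ) :
    ∫⁻ x, ENNReal.ofReal (Real.exp (c * x)) ∂(gaussianReal 0 1) =
      ENNReal.ofReal (Real.exp (c ^ 2 / 2)) := by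
  have h := mgf_gaussianReal (p := gaussianReal 0 1) (X := id) (μ := 0) (v := 1) (by simp) c
  rw [← ofReal_integral_eq_lintegral_ofReal (integrable_exp_mul_gaussianReal c)
    (ae_of_all _ fun x => (Real.exp_pos _).le)]
  congr 1
  simpa [mgf] using h

instance : IsProbabilityMeasure stdGaussianSeq := by unfold stdGaussianSeq; infer_instance

theorem lintegral_exp_sum_stdGaussianSeq (c : ℕ → ℝ) (n : ℕ) :
    ∫⁻ x, ENNReal.ofReal (Real.exp (∑ j ∈ Finset.range n, c j * x j)) ∂stdGaussianSeq =
      ENNReal.ofReal (Real.exp (∑ j ∈ Finset.range n, c j ^ 2 / 2)) := by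
  simp_rw [Real.exp_sum, ENNReal.ofReal_prod_of_nonneg fun _ _ => (Real.exp_pos _).le]
  rw [stdGaussianSeq, lintegral_infinitePi_prod _ _
    (f := fun j x => ENNReal.ofReal (Real.exp (c j * x))) fun i => by fun_prop]
  exact Finset.prod_congr rfl fun j _ => lintegral_exp_mul_gaussianReal _

/-- The partial sums are a martingale bounded in L¹, because |y| ≤ exp y + exp (-y) and the
exponential moments are controlled by the sum of c j ^ 2; Doob's convergence theorem applies. -/
theorem ae_tendsto_sum_mul_stdGaussianSeq {c : ℕ → ℝ} (hc : Summable fun j => c j ^ 2) :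
    ∀ᵐ x ∂stdGaussianSeq,
      ∃ l, Tendsto (fun n => ∑ j ∈ Finset.range n, c j * x j) atTop (𝓝 l) := by
  have hind : iIndepFun (fun j (x : ℕ → ℝ) => c j * x j) stdGaussianSeq :=
    iIndepFun_infinitePi (P := fun _ => gaussianReal 0 1) (X := fun j x => c j * x)
      fun i => by fun_prop
  have hX (j : ℕ) : StronglyMeasurable (fun x : ℕ → ℝ => c j * x j) :=
    Measurable.stronglyMeasurable (by fun_prop)
  have hmp (j : ℕ) : MeasurePreserving (fun x : ℕ → ℝ => x j) stdGaussianSeq (gaussianReal 0 1) :=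
    measurePreserving_eval_infinitePi (fun _ => gaussianReal 0 1) j
  have hint (j : ℕ) : Integrable (fun x : ℕ → ℝ => c j * x j) stdGaussianSeq :=
    ((hmp j).integrable_comp_of_integrable
      (g := fun y => y) ((memLp_id_gaussianReal 1).integrable le_rfl)).const_mul _
  have hmean (j : ℕ) : ∫ x, c j * x j ∂stdGaussianSeq = 0 := by
    rw [integral_const_mul]
    have := (hmp j).map_eq ▸ integral_map (hmp j).measurable.aemeasurable
      (f := fun y : ℝ => y) aestronglyMeasurable_id
    rw [← this, integral_id_gaussianReal, mul_zero]
  let F := Filtration.natural (fun j (x : ℕ → ℝ) => c j * x j) hX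
  -- The natural filtration at time n already contains coordinate n, so n + 1 terms are summed.
  let S : ℕ → (ℕ → ℝ) → ℝ := fun n => ∑ j ∈ Finset.range (n + 1), fun x => c j * x j
  have hadp : StronglyAdapted F S := fun n =>
    Finset.stronglyMeasurable_sum _ fun j hj =>
      (Filtration.stronglyAdapted_natural hX j).mono
        (F.mono (Nat.lt_succ_iff.1 (Finset.mem_range.1 hj)))
  have hSint (n : ℕ) : Integrable (S n) stdGaussianSeq :=
    integrable_finsetSum' _ fun j _ => hint j
  have hmart : Martingale S F stdGaussianSeq := by
    refine martingale_nat hadp hSint fun n => ?_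
    have hstep : S (n + 1) = S n + fun x => c (n + 1) * x (n + 1) := Finset.sum_range_succ _ _
    rw [hstep]
    have h1 := condExp_add (hSint n) (hint (n + 1)) (F n)
    have h2 := hind.condExp_natural_ae_eq_of_lt hX (Nat.lt_succ_self n)
    rw [condExp_of_stronglyMeasurable (F.le n) (hadp n) (hSint n)] at h1
    filter_upwards [h1, h2] with x hx1 hx2
    rw [hx1, Pi.add_apply, hx2, hmean, add_zero]
  have hbdd (n : ℕ) : eLpNorm (S n) 1 stdGaussianSeq ≤
      ((2 * Real.exp (∑' j, c j ^ 2 / 2)).toNNReal : ENNReal) := by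
    have hle (n : ℕ) : ∑ j ∈ Finset.range n, c j ^ 2 / 2 ≤ ∑' j, c j ^ 2 / 2 :=
      (hc.div_const 2).sum_le_tsum _ fun j _ => by positivity
    calc eLpNorm (S n) 1 stdGaussianSeq
        ≤ ∫⁻ x, (ENNReal.ofReal (Real.exp (∑ j ∈ Finset.range (n + 1), c j * x j)) +
          ENNReal.ofReal (Real.exp (∑ j ∈ Finset.range (n + 1), -c j * x j)))
            ∂stdGaussianSeq := by
          rw [eLpNorm_one_eq_lintegral_enorm]
          refine lintegral_mono fun x => ?_
          have hS : S n x = ∑ j ∈ Finset.range (n + 1), c j * x j := by simp [S]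
          rw [hS, ← ENNReal.ofReal_add (Real.exp_pos _).le (Real.exp_pos _).le,
            Real.enorm_eq_ofReal_abs]
          refine ENNReal.ofReal_le_ofReal ?_
          simp only [neg_mul, Finset.sum_neg_distrib]
          generalize ∑ j ∈ Finset.range (n + 1), c j * x j = y
          rw [abs_le]
          constructor <;>
            linarith [Real.add_one_le_exp y, Real.add_one_le_exp (-y), Real.exp_pos y,
              Real.exp_pos (-y)]
      _ = 2 * ENNReal.ofReal (Real.exp (∑ j ∈ Finset.range (n + 1), c j ^ 2 / 2)) := by
          rw [lintegral_add_left (by fun_prop), lintegral_exp_sum_stdGaussianSeq,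
            lintegral_exp_sum_stdGaussianSeq (fun j => -c j)]
          simp only [neg_sq, two_mul]
      _ ≤ _ := by
          change _ ≤ ENNReal.ofReal _
          rw [ENNReal.ofReal_mul two_pos.le, ENNReal.ofReal_ofNat]
          gcongr
          exact hle _
  filter_upwards [hmart.submartingale.exists_ae_tendsto_of_bdd hbdd] with x ⟨l, hl⟩
  refine ⟨l, (tendsto_add_atTop_iff_nat 1).1 ?_⟩
  simpa [S] using hl

/-- The change of kinetic energy over the first `n` coordinates under a shift by `c`. -/
def shiftEnergy (c x : ℕ → ℝ) (n : ℕ) : ℝ :=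
  ∑ j ∈ Finset.range n, 2⁻¹ * ((x j + c j) ^ 2 - x j ^ 2)

theorem ae_tendsto_shiftEnergy {c : ℕ → ℝ} (hc : Summable fun j => c j ^ 2) :
    ∀ᵐ x ∂stdGaussianSeq, ∃ l, Tendsto (shiftEnergy c x) atTop (𝓝 l) := by
  filter_upwards [ae_tendsto_sum_mul_stdGaussianSeq hc] with x ⟨l, hl⟩
  refine ⟨l + ∑' j, c j ^ 2 / 2,
    (hl.add (hc.div_const 2).hasSum.tendsto_sum_nat).congr fun n => ?_⟩
  rw [shiftEnergy, ← Finset.sum_add_distrib]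
  exact Finset.sum_congr rfl fun j _ => by ring

/-- **Cameron–Martin** for the standard Gaussian sequence. -/
theorem stdGaussianSeq_withDensity_shift_map {c : ℕ → ℝ} (hc : Summable fun j => c j ^ 2)
    {δ : (ℕ → ℝ) → ℝ}
    (hδ : ∀ᵐ x ∂stdGaussianSeq, Tendsto (shiftEnergy c x) atTop (𝓝 (δ x))) :
    (stdGaussianSeq.withDensity fun x => ENNReal.ofReal (Real.exp (-δ x))).map (· + c) =
      stdGaussianSeq := by
  let L : ℕ → (ℕ → ℝ) → ENNReal := fun n x => ∏ j ∈ Finset.range n, shiftDensity 1 (c j) (x j)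
  have hLE (n : ℕ) (x : ℕ → ℝ) : L n x = ENNReal.ofReal (Real.exp (-shiftEnergy c x n)) := by
    simp [L, prod_shiftDensity _ (fun _ => 1), shiftEnergy]
  have hLm (n : ℕ) : Measurable (L n) := by fun_prop
  -- The second moment of L n is exp(-Σ c²) · exp(Σ (2c)² / 2) = exp(Σ c²), bounded in n because c
  -- is square summable.
  have hLsq (n : ℕ) : ∫⁻ x, L n x ^ 2 ∂stdGaussianSeq ≤
      ENNReal.ofReal (Real.exp (∑' j, c j ^ 2)) := by
    have hpt (x : ℕ → ℝ) : L n x ^ 2 =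
        ENNReal.ofReal (Real.exp (-∑ j ∈ Finset.range n, c j ^ 2)) *
          ENNReal.ofReal (Real.exp (∑ j ∈ Finset.range n, (-2 * c j) * x j)) := by
      rw [hLE, ← ENNReal.ofReal_pow (Real.exp_pos _).le, ← Real.exp_nat_mul,
        ← ENNReal.ofReal_mul (Real.exp_pos _).le, ← Real.exp_add, shiftEnergy,
        ← Finset.sum_neg_distrib, ← Finset.sum_neg_distrib, Finset.mul_sum,
        ← Finset.sum_add_distrib]
      congr 2
      exact Finset.sum_congr rfl fun j _ => by push_cast; ring
    simp_rw [hpt]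
    rw [lintegral_const_mul _ (by fun_prop), lintegral_exp_sum_stdGaussianSeq (fun j => -2 * c j),
      ← ENNReal.ofReal_mul (Real.exp_pos _).le, ← Real.exp_add, ← Finset.sum_neg_distrib,
      ← Finset.sum_add_distrib]
    refine ENNReal.ofReal_le_ofReal (Real.exp_le_exp.2 ?_)
    calc _ = ∑ j ∈ Finset.range n, c j ^ 2 := Finset.sum_congr rfl fun j _ => by ring
      _ ≤ _ := hc.sum_le_tsum _ fun j _ => by positivity
  have hlim : ∀ᵐ x ∂stdGaussianSeq,
      Tendsto (fun n => L n x) atTop (𝓝 (ENNReal.ofReal (Real.exp (-δ x)))) := by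
    filter_upwards [hδ] with x hx
    simp_rw [hLE]
    exact ENNReal.tendsto_ofReal (Real.continuous_exp.continuousAt.tendsto.comp hx.neg)
  refine Measure.eq_infinitePi _ fun s t ht => ?_
  have hm : MeasurableSet ((s : Set ℕ).pi t) :=
    MeasurableSet.pi (Finset.countable_toSet s) fun i _ => ht i
  rw [Measure.map_apply (by fun_prop) hm, withDensity_apply _ (hm.preimage (by fun_prop))]
  -- For a fixed cylinder the integrals of L n converge to the integral of the limiting density, and
  -- they are constant as soon as n covers the base of the cylinder.
  refine tendsto_nhds_unique (tendsto_lintegral_of_lintegral_sq_le hLm (ae_restrict_of_ae hlim)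
    ENNReal.ofReal_ne_top fun n => (setLIntegral_le_lintegral _ _).trans (hLsq n))
    (tendsto_const_nhds.congr' ?_)
  obtain ⟨N, hN⟩ := s.exists_nat_subset_range
  filter_upwards [eventually_ge_atTop N] with n hn
  exact (setLIntegral_infinitePi_prod_shift (fun _ => gaussianReal 0 1)
    (fun i => measurable_shiftDensity 1 (c i))
    (fun i => gaussianReal_withDensity_shiftDensity_map one_ne_zero (c i))
    (hN.trans (Finset.range_mono hn)) ht).symm

/-! ### Maps that compensate their energy change -/

variable {q : ℕ}

instance (q : ℕ) : SFinite (refMeasure q) := by unfold refMeasure; infer_instance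

instance (a : Fin q → ℝ) : IsProbabilityMeasure (velocityLaw a) := by
  unfold velocityLaw; infer_instance

instance (a : Fin q → ℝ) : SFinite (jointRef a) := by unfold jointRef; infer_instance

theorem lintegral_mul_comp_of_map_withDensity_eq {α β : Type*} [MeasurableSpace α]
    [MeasurableSpace β] {μ : Measure α} {ν : Measure β} {e : α → ENNReal} (he : Measurable e)
    {T : α → β} (hT : Measurable T) (h : (μ.withDensity e).map T = ν) {f : β → ENNReal}
    (hf : Measurable f) : ∫⁻ x, e x * f (T x) ∂μ = ∫⁻ y, f y ∂ν := by
  rw [← h, lintegral_map hf hT,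
    lintegral_withDensity_eq_lintegral_mul _ he (g := fun x => f (T x)) (hf.comp hT)]
  rfl

/-- `T` changes the energy (without potential) by `δ` almost everywhere, and it transports the
reference measure according to that change. -/
structure IsEnergyShift (a : Fin q → ℝ) (T : State q × State q → State q × State q)
    (δ : State q × State q → ℝ) : Prop where
  measurable : Measurable T
  measurable_change : Measurable δ
  tendsto : ∀ᵐ w ∂(jointRef a),
    Tendsto (fun n => truncEnergy 0 a n (T w) - truncEnergy 0 a n w) atTop (𝓝 (δ w))
  map_eq : ((jointRef a).withDensity fun w => ENNReal.ofReal (Real.exp (-δ w))).map T = jointRef a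

namespace IsEnergyShift

variable {a : Fin q → ℝ} {T T' : State q × State q → State q × State q}
  {δ δ' : State q × State q → ℝ}

/-- The weight exp(-δ) never vanishes, so preimages of null sets are null. -/
theorem ae_comp (hT : IsEnergyShift a T δ) {P : State q × State q → Prop}
    (hP : ∀ᵐ w ∂(jointRef a), P w) : ∀ᵐ w ∂(jointRef a), P (T w) := by
  rw [← hT.map_eq] at hP
  have h := ae_of_ae_map hT.measurable.aemeasurable hP
  rw [ae_withDensity_iff (by have := hT.measurable_change; fun_prop)] at h
  filter_upwards [h] with w hw
  exact hw (ENNReal.ofReal_pos.2 (Real.exp_pos _)).ne'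

theorem lintegral_comp (hT : IsEnergyShift a T δ) {f : State q × State q → ENNReal}
    (hf : Measurable f) :
    ∫⁻ w, ENNReal.ofReal (Real.exp (-δ w)) * f (T w) ∂(jointRef a) = ∫⁻ w, f w ∂(jointRef a) := by
  exact lintegral_mul_comp_of_map_withDensity_eq hT.measurable_change.neg.exp.ennreal_ofReal
    hT.measurable hT.map_eq hf

theorem of_lintegral (hT : Measurable T) (hδ : Measurable δ)
    (hlim : ∀ᵐ w ∂(jointRef a),
      Tendsto (fun n => truncEnergy 0 a n (T w) - truncEnergy 0 a n w) atTop (𝓝 (δ w)))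
    (h : ∀ f : State q × State q → ENNReal, Measurable f →
      ∫⁻ w, ENNReal.ofReal (Real.exp (-δ w)) * f (T w) ∂(jointRef a) = ∫⁻ w, f w ∂(jointRef a)) :
    IsEnergyShift a T δ := by
  refine ⟨hT, hδ, hlim, Measure.ext_of_lintegral _ fun f hf => ?_⟩
  rw [← h f hf, lintegral_map hf hT, lintegral_withDensity_eq_lintegral_mul _ (by fun_prop)
    (g := fun w => f (T w)) (hf.comp hT)]
  rfl

theorem comp (hT' : IsEnergyShift a T' δ') (hT : IsEnergyShift a T δ) :
    IsEnergyShift a (T' ∘ T) fun w => δ w + δ' (T w) := by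
  have hm := hT.measurable
  have hm' := hT'.measurable
  have hδ := hT.measurable_change
  have hδ' := hT'.measurable_change
  refine of_lintegral (by fun_prop) (by fun_prop) ?_ fun f hf => ?_
  · filter_upwards [hT.tendsto, hT.ae_comp hT'.tendsto] with w h h'
    refine (h.add h').congr fun n => ?_
    simp only [Function.comp_apply]
    ring
  · rw [← hT'.lintegral_comp hf, ← hT.lintegral_comp
      (f := fun w => ENNReal.ofReal (Real.exp (-δ' w)) * f (T' w)) (by fun_prop)]
    refine lintegral_congr fun w => ?_
    rw [neg_add, Real.exp_add, ENNReal.ofReal_mul (Real.exp_pos _).le, mul_assoc]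
    rfl

theorem of_measurePreserving (hT : MeasurePreserving T (jointRef a) (jointRef a))
    (hE : ∀ n w, truncEnergy 0 a n (T w) = truncEnergy 0 a n w) :
    IsEnergyShift a T fun _ => 0 :=
  ⟨hT.measurable, measurable_const, ae_of_all _ fun w => by simp [hE], by simp [hT.map_eq]⟩

theorem exists_iterate (hT : IsEnergyShift a T δ) (I : ℕ) : ∃ δ, IsEnergyShift a T^[I] δ := by
  induction I with
  | zero => exact ⟨_, of_measurePreserving (MeasurePreserving.id _) fun _ _ => rfl⟩
  | succ I ih =>
    obtain ⟨δ', h⟩ := ih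
    exact ⟨_, h.comp hT⟩

end IsEnergyShift

/-! ### Flip and drift preserve the reference measure -/

/-- The flip of the velocity. -/
def flipVelocity (w : State q × State q) : State q × State q := (w.1, -w.2)

theorem measurePreserving_neg_velocityLaw (a : Fin q → ℝ) :
    MeasurePreserving (fun v => -v) (velocityLaw a) (velocityLaw a) := by
  have h1 : MeasurePreserving (fun v : ℕ → ℝ => -v) stdGaussianSeq stdGaussianSeq := by
    refine ⟨by fun_prop, ?_⟩
    have h := Measure.infinitePi_map_pi (fun _ : ℕ => gaussianReal 0 1)
      (f := fun _ x => -x) fun _ => measurable_neg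
    simp only [gaussianReal_map_neg, neg_zero] at h
    exact h
  have h2 : MeasurePreserving (fun v : Fin q → ℝ => -v)
      (Measure.pi fun i => gaussianReal 0 (a i)⁻¹.toNNReal)
      (Measure.pi fun i => gaussianReal 0 (a i)⁻¹.toNNReal) := by
    refine measurePreserving_pi _ _ fun i => ⟨measurable_neg, ?_⟩
    exact gaussianReal_map_neg.trans (by rw [neg_zero])
  exact h1.prod h2

theorem measurePreserving_flipVelocity (a : Fin q → ℝ) :
    MeasurePreserving flipVelocity (jointRef a) (jointRef a) :=
  (MeasurePreserving.id _).prod (measurePreserving_neg_velocityLaw a)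

theorem truncEnergy_flipVelocity (Φ : State q → ℝ) (a : Fin q → ℝ) (n : ℕ)
    (w : State q × State q) : truncEnergy Φ a n (flipVelocity w) = truncEnergy Φ a n w := by
  simp [truncEnergy, flipVelocity]

theorem isEnergyShift_flipVelocity (a : Fin q → ℝ) :
    IsEnergyShift a flipVelocity fun _ => 0 :=
  .of_measurePreserving (measurePreserving_flipVelocity a) fun n w =>
    truncEnergy_flipVelocity 0 a n w

theorem measurePreserving_prodProdProdComm {α β γ δ : Type*} [MeasurableSpace α]
    [MeasurableSpace β] [MeasurableSpace γ] [MeasurableSpace δ] (μ : Measure α) (ν : Measure β)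
    (κ : Measure γ) (τ : Measure δ) [SFinite μ] [SFinite ν] [SFinite κ] [SFinite τ] :
    MeasurePreserving (fun p : (α × β) × (γ × δ) => ((p.1.1, p.2.1), (p.1.2, p.2.2)))
      ((μ.prod ν).prod (κ.prod τ)) ((μ.prod κ).prod (ν.prod τ)) := by
  have h1 := measurePreserving_prodAssoc μ ν (κ.prod τ)
  have h2 := (measurePreserving_prodAssoc ν κ τ).symm
  have h3 := (measurePreserving_prodAssoc κ ν τ).comp
    (((Measure.measurePreserving_swap (μ := ν) (ν := κ)).prod (MeasurePreserving.id τ)).comp h2)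
  have h4 := (measurePreserving_prodAssoc μ κ (ν.prod τ)).symm
  exact h4.comp (((MeasurePreserving.id μ).prod h3).comp h1)

/-- A planar standard Gaussian is rotation invariant; rotate each pair (z_j, v_j) separately in the
product of planes, then unzip. -/
theorem measurePreserving_rotation_stdGaussianSeq (t : ℝ) :
    MeasurePreserving (fun p : (ℕ → ℝ) × (ℕ → ℝ) =>
      (Real.cos t • p.1 + Real.sin t • p.2, -Real.sin t • p.1 + Real.cos t • p.2))
      (stdGaussianSeq.prod stdGaussianSeq) (stdGaussianSeq.prod stdGaussianSeq) := by
  refine ⟨by fun_prop, ?_⟩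
  have hrot : ((gaussianReal 0 1).prod (gaussianReal 0 1)).map
      (ContinuousLinearMap.rotation t) = (gaussianReal 0 1).prod (gaussianReal 0 1) :=
    IsGaussian.map_rotation_eq_self (by simp) t
  have h := Measure.infinitePi_map_pi
    (fun _ : ℕ => (gaussianReal 0 1).prod (gaussianReal 0 1))
    (f := fun _ => ContinuousLinearMap.rotation t) fun _ => by fun_prop
  simp only [hrot] at h
  rw [stdGaussianSeq, ← infinitePi_prod_map_unzip, Measure.map_map (by fun_prop) (by fun_prop)]
  conv_rhs => rw [← h]
  rw [Measure.map_map (by fun_prop) (by fun_prop)]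
  rfl

/-- For a fixed velocity the map is a translation of the location. The swaps put the velocity first,
as the base of the skew product. -/
theorem measurePreserving_shear {E : Type*} [AddCommGroup E] [Module ℝ E] [MeasurableSpace E]
    [MeasurableAdd₂ E] [MeasurableConstSMul ℝ E] (μ ν : Measure E) [SFinite μ] [SFinite ν]
    [μ.IsAddRightInvariant] (t : ℝ) :
    MeasurePreserving (fun p : E × E => (p.1 + t • p.2, p.2)) (μ.prod ν) (μ.prod ν) := by
  have h := (MeasurePreserving.id ν).skew_product (μc := μ) (μd := μ)
    (g := fun v x => x + t • v) (by fun_prop)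
    (ae_of_all _ fun v => map_add_right_eq_self μ (t • v))
  exact Measure.measurePreserving_swap.comp (h.comp Measure.measurePreserving_swap)

theorem measurePreserving_drift (a : Fin q → ℝ) (t : ℝ) :
    MeasurePreserving (drift t) (jointRef a) (jointRef a) := by
  have h1 := measurePreserving_prodProdProdComm stdGaussianSeq (volume : Measure (Fin q → ℝ))
    stdGaussianSeq (Measure.pi fun i => gaussianReal 0 (a i)⁻¹.toNNReal)
  have h2 := (measurePreserving_rotation_stdGaussianSeq t).prod (measurePreserving_shear
    (volume : Measure (Fin q → ℝ)) (Measure.pi fun i => gaussianReal 0 (a i)⁻¹.toNNReal) t)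
  have h3 := measurePreserving_prodProdProdComm stdGaussianSeq stdGaussianSeq
    (volume : Measure (Fin q → ℝ)) (Measure.pi fun i => gaussianReal 0 (a i)⁻¹.toNNReal)
  exact h3.comp (h2.comp h1)

theorem isEnergyShift_drift (a : Fin q → ℝ) (t : ℝ) : IsEnergyShift a (drift t) fun _ => 0 := by
  refine .of_measurePreserving (measurePreserving_drift a t) fun n w => ?_
  have hsum : ∑ j ∈ Finset.range n, (Real.cos t * w.1.1 j + Real.sin t * w.2.1 j) ^ 2 +
      ∑ j ∈ Finset.range n, (-(Real.sin t * w.1.1 j) + Real.cos t * w.2.1 j) ^ 2 =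
      ∑ j ∈ Finset.range n, w.1.1 j ^ 2 + ∑ j ∈ Finset.range n, w.2.1 j ^ 2 := by
    rw [← Finset.sum_add_distrib, ← Finset.sum_add_distrib]
    refine Finset.sum_congr rfl fun j _ => ?_
    linear_combination (w.1.1 j ^ 2 + w.2.1 j ^ 2) * Real.sin_sq_add_cos_sq t
  simp only [truncEnergy, drift, Pi.add_apply, Pi.smul_apply, smul_eq_mul, Pi.zero_apply, neg_mul]
  linear_combination 2⁻¹ * hsum

/-! ### The kick as a Gaussian shift of the velocity -/

/-- The change of `⟨v, M v⟩ / 2`, over the first `n` coordinates of `v_z`, under a shift by `c`. -/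
def velocityShiftEnergy (a : Fin q → ℝ) (c v : State q) (n : ℕ) : ℝ :=
  shiftEnergy c.1 v.1 n +
    ∑ i, (2 * ((a i)⁻¹.toNNReal : ℝ))⁻¹ * ((v.2 i + c.2 i) ^ 2 - v.2 i ^ 2)

theorem ae_tendsto_velocityShiftEnergy (a : Fin q → ℝ) {c : State q}
    (hc : Summable fun j => c.1 j ^ 2) :
    ∀ᵐ v ∂(velocityLaw a), ∃ l, Tendsto (velocityShiftEnergy a c v) atTop (𝓝 l) := by
  filter_upwards [Measure.quasiMeasurePreserving_fst.ae (ae_tendsto_shiftEnergy hc)] with v ⟨l, hl⟩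
  exact ⟨_, hl.add tendsto_const_nhds⟩

theorem measurable_shiftEnergy {α : Type*} [MeasurableSpace α] {c x : α → ℕ → ℝ}
    (hc : Measurable c) (hx : Measurable x) (n : ℕ) :
    Measurable fun s => shiftEnergy (c s) (x s) n := by
  unfold shiftEnergy; fun_prop

theorem velocityLaw_withDensity_shift_map {a : Fin q → ℝ} (ha : ∀ i, 0 < a i) {c : State q}
    (hc : Summable fun j => c.1 j ^ 2) {δ : State q → ℝ}
    (hδ : ∀ᵐ v ∂(velocityLaw a), Tendsto (velocityShiftEnergy a c v) atTop (𝓝 (δ v))) :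
    ((velocityLaw a).withDensity fun v => ENNReal.ofReal (Real.exp (-δ v))).map (· + c) =
      velocityLaw a := by
  -- A measurable version of the z-part of δ, so that the density splits almost everywhere into a
  -- z-factor and a θ-factor.
  let δ₁ : (ℕ → ℝ) → ℝ := fun z => limUnder atTop (shiftEnergy c.1 z)
  have hδ₁ : Measurable δ₁ :=
    measurable_limUnder fun n => measurable_shiftEnergy measurable_const measurable_id n
  have hlim : ∀ᵐ z ∂stdGaussianSeq, Tendsto (shiftEnergy c.1 z) atTop (𝓝 (δ₁ z)) :=
    (ae_tendsto_shiftEnergy hc).mono fun z hz => tendsto_nhds_limUnder hz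
  have hdens : (velocityLaw a).withDensity (fun v => ENNReal.ofReal (Real.exp (-δ v))) =
      (velocityLaw a).withDensity fun v => ENNReal.ofReal (Real.exp (-δ₁ v.1)) *
        ∏ i, shiftDensity (a i)⁻¹.toNNReal (c.2 i) (v.2 i) := by
    refine withDensity_congr_ae ?_
    filter_upwards [hδ, Measure.quasiMeasurePreserving_fst.ae hlim] with v hv hv₁
    rw [tendsto_nhds_unique hv (hv₁.add tendsto_const_nhds), prod_shiftDensity, neg_add,
      Real.exp_add, ENNReal.ofReal_mul (Real.exp_pos _).le]
  have hθ := pi_withDensity_prod_shift_map (fun i => gaussianReal 0 (a i)⁻¹.toNNReal)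
    (fun i => measurable_shiftDensity (a i)⁻¹.toNNReal (c.2 i))
    (fun i => gaussianReal_withDensity_shiftDensity_map
      (Real.toNNReal_pos.2 (inv_pos.2 (ha i))).ne' (c.2 i))
  have hz := stdGaussianSeq_withDensity_shift_map hc hlim
  rw [hdens, velocityLaw, 
    ← prod_withDensity (f := fun z => ENNReal.ofReal (Real.exp (-δ₁ z)))
      (g := fun θ : Fin q → ℝ => ∏ i, shiftDensity (a i)⁻¹.toNNReal (c.2 i) (θ i))
      (by fun_prop) (by fun_prop)]
  conv_rhs => rw [← hz, ← hθ]
  rw [Measure.map_prod_map _ _ (by fun_prop) (by fun_prop)]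
  rfl

theorem truncEnergy_add_velocity {a : Fin q → ℝ} (ha : ∀ i, 0 < a i) (n : ℕ) (x v c : State q) :
    truncEnergy 0 a n (x, v + c) - truncEnergy 0 a n (x, v) = velocityShiftEnergy a c v n := by
  simp only [truncEnergy, velocityShiftEnergy, shiftEnergy, Prod.fst_add, Prod.snd_add,
    Pi.add_apply, Pi.zero_apply]
  have h (i : Fin q) : (2 * ((a i)⁻¹.toNNReal : ℝ))⁻¹ = 2⁻¹ * a i := by
    rw [Real.coe_toNNReal _ (inv_pos.2 (ha i)).le, mul_inv, inv_inv]
  simp only [h, mul_assoc, mul_sub, Finset.sum_sub_distrib, ← Finset.mul_sum]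
  ring

/-- Given x, the shift g x is a constant, so the velocity statement holds on almost every fibre, and
Fubini assembles the fibres. The limit is taken with `limUnder` to be jointly measurable in (x, v).
-/
theorem isEnergyShift_add_velocity {a : Fin q → ℝ} (ha : ∀ i, 0 < a i) {g : State q → State q}
    (hg : Measurable g) (hg2 : ∀ᵐ x ∂(refMeasure q), Summable fun j => (g x).1 j ^ 2) :
    IsEnergyShift a (fun w => (w.1, w.2 + g w.1))
      fun w => limUnder atTop (velocityShiftEnergy a (g w.1) w.2) := by
  have hE (n : ℕ) : Measurable fun w : State q × State q =>
      velocityShiftEnergy a (g w.1) w.2 n := by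
    unfold velocityShiftEnergy shiftEnergy; fun_prop
  have hδ : Measurable fun w : State q × State q =>
      limUnder atTop (velocityShiftEnergy a (g w.1) w.2) := measurable_limUnder hE
  refine .of_lintegral (by fun_prop) hδ ?_ fun f hf => ?_
  · simp_rw [truncEnergy_add_velocity ha]
    suffices ∀ᵐ w ∂(jointRef a),
        ∃ l, Tendsto (velocityShiftEnergy a (g w.1) w.2) atTop (𝓝 l) from
      this.mono fun w hw => tendsto_nhds_limUnder hw
    have hset : MeasurableSet {w : State q × State q |
        ∃ l, Tendsto (velocityShiftEnergy a (g w.1) w.2) atTop (𝓝 l)} :=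
      measurableSet_exists_tendsto hE
    refine (Measure.ae_prod_iff_ae_ae hset).2 (hg2.mono fun x hx => ?_)
    filter_upwards [ae_tendsto_velocityShiftEnergy a (c := g x) hx] with v hv
    exact hv
  · have hfm : Measurable fun w : State q × State q => f (w.1, w.2 + g w.1) :=
      hf.comp (by fun_prop)
    have hprod : Measurable fun w : State q × State q =>
        ENNReal.ofReal (Real.exp (-limUnder atTop (velocityShiftEnergy a (g w.1) w.2))) *
          f (w.1, w.2 + g w.1) := hδ.neg.exp.ennreal_ofReal.mul hfm
    rw [jointRef, lintegral_prod _ hprod.aemeasurable,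
      lintegral_prod _ hf.aemeasurable]
    refine lintegral_congr_ae (hg2.mono fun x hx => ?_)
    have hδx : Measurable fun v => limUnder atTop (velocityShiftEnergy a (g x) v) :=
      measurable_limUnder (f := fun n v => velocityShiftEnergy a (g x) v n) fun n => by
        unfold velocityShiftEnergy shiftEnergy; fun_prop
    have hfx : Measurable fun v => f (x, v) := hf.comp measurable_prodMk_left
    have hlim : ∀ᵐ v ∂(velocityLaw a), Tendsto (velocityShiftEnergy a (g x) v) atTop
        (𝓝 (limUnder atTop (velocityShiftEnergy a (g x) v))) := by
      filter_upwards [ae_tendsto_velocityShiftEnergy a (c := g x) hx] with v hv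
      exact tendsto_nhds_limUnder hv
    have key := velocityLaw_withDensity_shift_map ha (c := g x) hx
      (δ := fun v => limUnder atTop (velocityShiftEnergy a (g x) v)) hlim
    have he : Measurable fun v =>
        ENNReal.ofReal (Real.exp (-limUnder atTop (velocityShiftEnergy a (g x) v))) :=
      hδx.neg.exp.ennreal_ofReal
    exact lintegral_mul_comp_of_map_withDensity_eq he (measurable_add_const (g x)) key hfx

theorem measurable_grad {Φ : State q → ℝ} (hΦ : Measurable Φ) (hdiff : HasPartials Φ) :
    Measurable (grad Φ) := by
  refine Measurable.prodMk (measurable_pi_iff.2 fun j => ?_) (measurable_pi_iff.2 fun i => ?_)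
  · refine measurable_deriv_of_differentiableAt
      (F := fun x s => Φ (Function.update x.1 j s, x.2)) (t := fun x => x.1 j) (fun r => ?_)
      fun x => (hdiff x).1 j
    refine hΦ.comp (Measurable.prodMk ?_ measurable_snd)
    exact measurable_update'.comp (f := fun x : State q => (x.1, x.1 j + r)) (by fun_prop)
  · refine measurable_deriv_of_differentiableAt
      (F := fun x s => Φ (x.1, Function.update x.2 i s)) (t := fun x => x.2 i) (fun r => ?_)
      fun x => (hdiff x).2 i
    refine hΦ.comp (Measurable.prodMk measurable_fst ?_)
    exact measurable_update'.comp (f := fun x : State q => (x.2, x.2 i + r)) (by fun_prop)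

theorem measurable_massInv (a : Fin q → ℝ) : Measurable (massInv a) := by
  unfold massInv; fun_prop

/-- Positivity of p is what transfers the ℓ² assumption from the prior to the reference measure. -/
theorem refMeasure_absolutelyContinuous_priorMeasure {p : (Fin q → ℝ) → ℝ} (hp : Measurable p)
    (hp_pos : ∀ θ, 0 < p θ) : refMeasure q ≪ priorMeasure p :=
  Measure.AbsolutelyContinuous.rfl.prod (withDensity_absolutelyContinuous'
    hp.ennreal_ofReal.aemeasurable (ae_of_all _ fun θ => (ENNReal.ofReal_pos.2 (hp_pos θ)).ne'))

theorem isEnergyShift_kick {Φ : State q → ℝ} (hΦ : Measurable Φ) (hdiff : HasPartials Φ)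
    (hgrad : ∀ᵐ x ∂(refMeasure q), Memℓp (gradZ Φ x) 2) {a : Fin q → ℝ} (ha : ∀ i, 0 < a i)
    (t : ℝ) : ∃ δ, IsEnergyShift a (kick Φ a t) δ := by
  have hg : Measurable fun x => -(t • massInv a (grad Φ x)) :=
    (((measurable_massInv a).comp (measurable_grad hΦ hdiff)).const_smul t).neg
  have h := isEnergyShift_add_velocity ha hg (hgrad.mono fun x hx => by
    have hs := hx.summable (by norm_num)
    simp only [Real.norm_eq_abs, ENNReal.toReal_ofNat, Real.rpow_ofNat, sq_abs] at hs
    simpa [massInv, grad, mul_pow] using hs.mul_left (t ^ 2))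
  simp only [← sub_eq_add_neg] at h
  exact ⟨_, h⟩

theorem isEnergyShift_trajectory {Φ : State q → ℝ} (hΦ : Measurable Φ) (hdiff : HasPartials Φ)
    (hgrad : ∀ᵐ x ∂(refMeasure q), Memℓp (gradZ Φ x) 2) {a : Fin q → ℝ} (ha : ∀ i, 0 < a i)
    (h : ℝ) (I : ℕ) : ∃ δ, IsEnergyShift a (trajectory Φ a h I) δ := by
  obtain ⟨δ, hδ⟩ := isEnergyShift_kick hΦ hdiff hgrad ha (h / 2)
  exact (hδ.comp ((isEnergyShift_drift a h).comp hδ)).exists_iterate I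

/-! ### Time reversibility -/

theorem flipVelocity_flipVelocity (w : State q × State q) : flipVelocity (flipVelocity w) = w := by
  simp [flipVelocity]

theorem kick_flipVelocity_kick (Φ : State q → ℝ) (a : Fin q → ℝ) (t : ℝ) (w : State q × State q) :
    kick Φ a t (flipVelocity (kick Φ a t w)) = flipVelocity w := by
  simp [kick, flipVelocity]

theorem drift_flipVelocity_drift (t : ℝ) (w : State q × State q) :
    drift t (flipVelocity (drift t w)) = flipVelocity w := by
  refine Prod.ext (Prod.ext ?_ ?_) (Prod.ext ?_ ?_) <;> funext j <;>
    simp only [drift, flipVelocity, Prod.fst_neg, Prod.snd_neg, Pi.add_apply, Pi.smul_apply,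
      Pi.neg_apply, smul_eq_mul, neg_mul]
  · linear_combination w.1.1 j * Real.sin_sq_add_cos_sq t
  · ring
  · linear_combination -w.2.1 j * Real.sin_sq_add_cos_sq t

theorem leapfrog_flipVelocity_leapfrog (Φ : State q → ℝ) (a : Fin q → ℝ) (h : ℝ)
    (w : State q × State q) :
    leapfrog Φ a h (flipVelocity (leapfrog Φ a h w)) = flipVelocity w := by
  simp only [leapfrog, Function.comp_apply, kick_flipVelocity_kick, drift_flipVelocity_drift]

/-- The innermost step of the return path meets the last step of the outward path across the flip
and cancels it; induct. -/
theorem trajectory_flipVelocity_trajectory (Φ : State q → ℝ) (a : Fin q → ℝ) (h : ℝ) (I : ℕ)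
    (w : State q × State q) :
    trajectory Φ a h I (flipVelocity (trajectory Φ a h I w)) = flipVelocity w := by
  unfold trajectory
  induction I with
  | zero => rfl
  | succ I ih =>
    rw [Function.iterate_succ_apply, Function.iterate_succ_apply', leapfrog_flipVelocity_leapfrog,
      ih]

theorem truncDeltaH_flipVelocity_trajectory (Φ : State q → ℝ) (a : Fin q → ℝ) (h : ℝ) (I n : ℕ)
    (w : State q × State q) :
    truncDeltaH Φ a h I n (flipVelocity (trajectory Φ a h I w)) = -truncDeltaH Φ a h I n w := by
  simp only [truncDeltaH, trajectory_flipVelocity_trajectory, truncEnergy_flipVelocity, neg_sub]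

theorem truncDeltaH_eq (Φ : State q → ℝ) (a : Fin q → ℝ) (h : ℝ) (I n : ℕ)
    (w : State q × State q) :
    truncDeltaH Φ a h I n w = Φ (trajectory Φ a h I w).1 - Φ w.1 +
      (truncEnergy 0 a n (trajectory Φ a h I w) - truncEnergy 0 a n w) := by
  simp only [truncDeltaH, truncEnergy, Pi.zero_apply]
  ring

theorem measurable_deltaH {Φ : State q → ℝ} (hΦ : Measurable Φ) {a : Fin q → ℝ} {h : ℝ} {I : ℕ}
    (hT : Measurable (trajectory Φ a h I)) : Measurable (deltaH Φ a h I) := by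
  refine measurable_limUnder fun n => ?_
  have hE : Measurable (truncEnergy Φ a n) := by unfold truncEnergy; fun_prop
  exact (hE.comp hT).sub hE

/-! ### Density of the push-forward and detailed balance -/

section EnergyShift

variable {Φ : State q → ℝ} {a : Fin q → ℝ} {h : ℝ} {I : ℕ} {δ : State q × State q → ℝ}

theorem ae_tendsto_truncDeltaH (hδ : IsEnergyShift a (trajectory Φ a h I) δ) :
    ∀ᵐ w ∂(jointRef a), Tendsto (fun n => truncDeltaH Φ a h I n w) atTop
      (𝓝 (deltaH Φ a h I w)) := by
  filter_upwards [hδ.tendsto] with w hw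
  refine tendsto_nhds_limUnder
    ⟨Φ (trajectory Φ a h I w).1 - Φ w.1 + δ w, ?_⟩
  simp_rw [truncDeltaH_eq]
  exact tendsto_const_nhds.add hw

theorem ae_deltaH_eq (hδ : IsEnergyShift a (trajectory Φ a h I) δ) :
    ∀ᵐ w ∂(jointRef a), deltaH Φ a h I w = Φ (trajectory Φ a h I w).1 - Φ w.1 + δ w := by
  filter_upwards [hδ.tendsto, ae_tendsto_truncDeltaH hδ] with w hw hw'
  simp_rw [truncDeltaH_eq] at hw'
  exact tendsto_nhds_unique hw' (tendsto_const_nhds.add hw)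

/-- The sign change is exact for every truncation. To pass to the limit, the limit must also exist
at the image point, which holds almost everywhere since flip ∘ trajectory pulls null sets back to
null sets. -/
theorem ae_deltaH_flipVelocity_trajectory (hδ : IsEnergyShift a (trajectory Φ a h I) δ) :
    ∀ᵐ w ∂(jointRef a),
      deltaH Φ a h I (flipVelocity (trajectory Φ a h I w)) = -deltaH Φ a h I w := by
  filter_upwards [ae_tendsto_truncDeltaH hδ,
    ((isEnergyShift_flipVelocity a).comp hδ).ae_comp (ae_tendsto_truncDeltaH hδ)] with w hw hw'
  simp only [Function.comp_apply, truncDeltaH_flipVelocity_trajectory] at hw'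
  exact tendsto_nhds_unique hw' hw.neg

theorem lintegral_target (hΦ : Measurable Φ) {f : State q → ENNReal} (hf : Measurable f) :
    ∫⁻ x, f x ∂(target Φ) =
      (normConst Φ)⁻¹ * ∫⁻ x, ENNReal.ofReal (Real.exp (-Φ x)) * f x ∂(refMeasure q) := by
  rw [target, lintegral_smul_measure,
    lintegral_withDensity_eq_lintegral_mul _ (by fun_prop) hf]
  rfl

instance : SFinite (target Φ) := by unfold target; infer_instance

theorem lintegral_jointTarget (hΦ : Measurable Φ) {f : State q × State q → ENNReal}
    (hf : Measurable f) :
    ∫⁻ w, f w ∂(jointTarget Φ a) =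
      (normConst Φ)⁻¹ * ∫⁻ w, ENNReal.ofReal (Real.exp (-Φ w.1)) * f w ∂(jointRef a) := by
  have hm : Measurable fun w : State q × State q =>
      ENNReal.ofReal (Real.exp (-Φ w.1)) * f w := by fun_prop
  rw [jointTarget, lintegral_prod _ hf.aemeasurable,
    lintegral_target hΦ hf.lintegral_prod_right', jointRef, lintegral_prod _ hm.aemeasurable]
  congr 1
  refine lintegral_congr fun x => ?_
  rw [← lintegral_const_mul _ (f := fun v => f (x, v)) (hf.comp measurable_prodMk_left)]

theorem normConst_ne_zero (hΦ : Measurable Φ) : normConst Φ ≠ 0 := by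
  intro h0
  rw [normConst, lintegral_eq_zero_iff (by fun_prop)] at h0
  -- The total mass is that of Lebesgue measure on ℝ^q, non-zero even for q = 0.
  have hne : NeZero (refMeasure q) := ⟨fun h => by
    have hu := congrArg (· Set.univ) h
    simp only [refMeasure, ← Set.univ_prod_univ, Measure.prod_prod, measure_univ, one_mul,
      Measure.coe_zero, Pi.zero_apply, Measure.measure_univ_eq_zero] at hu
    exact NeZero.ne _ hu⟩
  obtain ⟨x, hx⟩ := h0.exists
  exact (ENNReal.ofReal_pos.2 (Real.exp_pos _)).ne' hx

theorem isProbabilityMeasure_target (hΦ : Measurable Φ) (hZ : normConst Φ ≠ ⊤) :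
    IsProbabilityMeasure (target Φ) := by
  refine ⟨?_⟩
  rw [target, Measure.smul_apply, withDensity_apply _ .univ, Measure.restrict_univ, smul_eq_mul]
  exact ENNReal.inv_mul_cancel (normConst_ne_zero hΦ) hZ

/-- After the change of variables ρ is only evaluated along the trajectory, so its values there
determine the push-forward. -/
theorem map_jointTarget_trajectory (hΦ : Measurable Φ)
    (hδ : IsEnergyShift a (trajectory Φ a h I) δ) {ρ : State q × State q → ENNReal}
    (hρ : Measurable ρ)
    (hρT : ∀ w, ρ (trajectory Φ a h I w) = (normConst Φ)⁻¹ *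
      ENNReal.ofReal (Real.exp (deltaH Φ a h I w - Φ (trajectory Φ a h I w).1))) :
    (jointTarget Φ a).map (trajectory Φ a h I) = (jointRef a).withDensity ρ := by
  have hT := hδ.measurable
  refine Measure.ext_of_lintegral _ fun f hf => ?_
  have hm : Measurable fun w : State q × State q =>
      ENNReal.ofReal (Real.exp (-Φ w.1)) * f (trajectory Φ a h I w) := by fun_prop
  rw [lintegral_map hf hT, lintegral_jointTarget hΦ (f := fun w => f (trajectory Φ a h I w))
      (hf.comp hT),
    lintegral_withDensity_eq_lintegral_mul _ hρ hf, ← hδ.lintegral_comp (hρ.mul hf),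
    ← lintegral_const_mul _ hm]
  refine lintegral_congr_ae ?_
  filter_upwards [ae_deltaH_eq hδ] with w hw
  have hexp : ENNReal.ofReal (Real.exp (-Φ w.1)) = ENNReal.ofReal (Real.exp (-δ w)) *
      ENNReal.ofReal (Real.exp (deltaH Φ a h I w - Φ (trajectory Φ a h I w).1)) := by
    rw [← ENNReal.ofReal_mul (Real.exp_pos _).le, ← Real.exp_add, hw]
    congr 2
    ring
  simp only [Pi.mul_apply, hρT, hexp]
  ring

theorem acceptProb_nonneg (w : State q × State q) : 0 ≤ acceptProb Φ a h I w :=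
  le_min zero_le_one (Real.exp_pos _).le

theorem acceptProb_le_one (w : State q × State q) : acceptProb Φ a h I w ≤ 1 := min_le_left _ _

theorem measurable_acceptProb (hΦ : Measurable Φ) (hT : Measurable (trajectory Φ a h I)) :
    Measurable (acceptProb Φ a h I) :=
  measurable_const.min (measurable_deltaH hΦ hT).neg.exp

/-- Detailed balance: an accepted proposal and an accepted current position have the same law. -/
theorem lintegral_acceptProb_mul_trajectory (hΦ : Measurable Φ)
    (hδ : IsEnergyShift a (trajectory Φ a h I) δ) {f : State q → ENNReal} (hf : Measurable f) :
    ∫⁻ w, ENNReal.ofReal (acceptProb Φ a h I w) * f (trajectory Φ a h I w).1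
        ∂(jointTarget Φ a) =
      ∫⁻ w, ENNReal.ofReal (acceptProb Φ a h I w) * f w.1 ∂(jointTarget Φ a) := by
  have hT := hδ.measurable
  have hα := measurable_acceptProb hΦ hT
  have hR := (isEnergyShift_flipVelocity a).comp hδ
  rw [lintegral_jointTarget hΦ (by fun_prop), lintegral_jointTarget hΦ (by fun_prop),
    ← hR.lintegral_comp (f := fun w => ENNReal.ofReal (Real.exp (-Φ w.1)) *
      (ENNReal.ofReal (acceptProb Φ a h I w) * f w.1)) (by fun_prop)]
  congr 1
  refine lintegral_congr_ae ?_
  filter_upwards [ae_deltaH_eq hδ, ae_deltaH_flipVelocity_trajectory hδ] with w hw hw'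
  -- Both sides equal min(exp(-Φ(x₀)), exp(-δ - Φ(x_I))): the acceptance probability at the reversed
  -- point is min(1, exp ΔH). The summand 0 is the energy change of the flip.
  have hexp : Real.exp (-Φ w.1) * acceptProb Φ a h I w = Real.exp (-(δ w + 0)) *
      (Real.exp (-Φ (trajectory Φ a h I w).1) *
        acceptProb Φ a h I (flipVelocity (trajectory Φ a h I w))) := by
    rw [acceptProb, acceptProb, hw', mul_min_of_nonneg _ _ (Real.exp_pos _).le,
      mul_min_of_nonneg _ _ (Real.exp_pos _).le, mul_min_of_nonneg _ _ (Real.exp_pos _).le,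
      mul_one, mul_one, ← Real.exp_add, ← Real.exp_add, ← Real.exp_add, ← Real.exp_add, min_comm,
      hw]
    congr 2 <;> ring
  have hexp' := congrArg ENNReal.ofReal hexp
  rw [ENNReal.ofReal_mul (Real.exp_pos _).le, ENNReal.ofReal_mul (Real.exp_pos _).le,
    ENNReal.ofReal_mul (Real.exp_pos _).le] at hexp'
  simp only [Function.comp_apply]
  rw [← mul_assoc, hexp']
  simp only [flipVelocity, mul_assoc]

/-! ### The Markov chain -/

theorem lintegral_Icc_ite {α : ℝ} (h0 : 0 ≤ α) (h1 : α ≤ 1) (A B : ENNReal) :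
    ∫⁻ u in Set.Icc (0 : ℝ) 1, (if u ≤ α then A else B) =
      ENNReal.ofReal α * A + ENNReal.ofReal (1 - α) * B := by
  rw [← Set.Icc_union_Ioc_eq_Icc h0 h1, lintegral_union measurableSet_Ioc
    (Set.disjoint_left.2 fun x hx hx' => not_lt.2 hx.2 hx'.1),
    setLIntegral_congr_fun (g := fun _ => A) measurableSet_Icc fun u hu => if_pos hu.2,
    setLIntegral_congr_fun (g := fun _ => B) measurableSet_Ioc fun u hu => if_neg (not_le.2 hu.1),
    setLIntegral_const, setLIntegral_const, Real.volume_Icc, Real.volume_Ioc, sub_zero,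
    mul_comm A, mul_comm B]

theorem measurable_update (hΦ : Measurable Φ) (hT : Measurable (trajectory Φ a h I)) :
    Measurable (update Φ a h I) := by
  have hα := measurable_acceptProb hΦ hT
  exact Measurable.ite (measurableSet_le (by fun_prop) (by fun_prop)) (by fun_prop) (by fun_prop)

instance : IsProbabilityMeasure ((volume : Measure ℝ).restrict (Set.Icc 0 1)) :=
  ⟨by simp⟩

theorem isMarkovKernel_chain (hΦ : Measurable Φ) (hT : Measurable (trajectory Φ a h I)) :
    IsMarkovKernel (chain Φ a h I) :=
  Kernel.IsMarkovKernel.map _ (measurable_update hΦ hT)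

theorem lintegral_chain (hΦ : Measurable Φ) (hT : Measurable (trajectory Φ a h I))
    {f : State q → ENNReal} (hf : Measurable f) (x : State q) :
    ∫⁻ y, f y ∂(chain Φ a h I x) =
      ∫⁻ v, (ENNReal.ofReal (acceptProb Φ a h I (x, v)) * f (trajectory Φ a h I (x, v)).1 +
        ENNReal.ofReal (1 - acceptProb Φ a h I (x, v)) * f x) ∂(velocityLaw a) := by
  have hu := measurable_update hΦ hT
  have hux : Measurable fun p => f (update Φ a h I (x, p)) :=
    hf.comp (hu.comp measurable_prodMk_left)
  rw [chain, Kernel.map_apply _ hu, Kernel.prod_apply, Kernel.id_apply, Kernel.const_apply,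
    Measure.dirac_prod, lintegral_map hf hu,
    lintegral_map (f := fun s => f (update Φ a h I s)) (hf.comp hu) measurable_prodMk_left]
  refine (lintegral_prod _ hux.aemeasurable).trans (lintegral_congr fun v => ?_)
  simp only [update, apply_ite f]
  exact lintegral_Icc_ite (acceptProb_nonneg _) (acceptProb_le_one _) _ _

/-- Detailed balance replaces the accepted proposal by the accepted current position; the weights of
acceptance and rejection then add up to 1. -/
theorem invariant_chain (hΦ : Measurable Φ) (hδ : IsEnergyShift a (trajectory Φ a h I) δ) :
    (chain Φ a h I).Invariant (target Φ) := by
  have hT := hδ.measurable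
  have hα := measurable_acceptProb hΦ hT
  refine Measure.ext_of_lintegral _ fun f hf => ?_
  rw [Measure.lintegral_bind (Kernel.aemeasurable _) hf.aemeasurable]
  simp_rw [lintegral_chain hΦ hT hf]
  have h1 : Measurable fun w : State q × State q =>
      ENNReal.ofReal (acceptProb Φ a h I w) * f (trajectory Φ a h I w).1 := by fun_prop
  have h2 : Measurable fun w : State q × State q =>
      ENNReal.ofReal (1 - acceptProb Φ a h I w) * f w.1 := by fun_prop
  have h3 : Measurable fun w : State q × State q =>
      ENNReal.ofReal (acceptProb Φ a h I w) * f w.1 := by fun_prop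
  have h12 := h1.add h2
  calc _ = ∫⁻ w, (ENNReal.ofReal (acceptProb Φ a h I w) * f (trajectory Φ a h I w).1 +
        ENNReal.ofReal (1 - acceptProb Φ a h I w) * f w.1) ∂(jointTarget Φ a) :=
        (lintegral_prod _ h12.aemeasurable).symm
    _ = ∫⁻ w, f w.1 ∂(jointTarget Φ a) := by
        rw [lintegral_add_left h1, lintegral_acceptProb_mul_trajectory hΦ hδ hf,
          ← lintegral_add_left h3]
        refine lintegral_congr fun w => ?_
        rw [← add_mul, ← ENNReal.ofReal_add (acceptProb_nonneg w)
          (sub_nonneg.2 (acceptProb_le_one w)), add_sub_cancel, ENNReal.ofReal_one, one_mul]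
    _ = ∫⁻ x, f x ∂(target Φ) := by
        rw [jointTarget, lintegral_prod (fun w => f w.1) (hf.comp measurable_fst).aemeasurable]
        simp

end EnergyShift

end AdvHMC

end

theorem proposition1 {q : ℕ} (Φ : AdvHMC.State q → ℝ) (hΦ : Measurable Φ)
    (hdiff : AdvHMC.HasPartials Φ) (hZ : AdvHMC.normConst Φ ≠ ⊤)
    (p : (Fin q → ℝ) → ℝ) (hp : Measurable p) (hp_pos : ∀ θ, 0 < p θ)
    (hgrad : ∀ᵐ x ∂(AdvHMC.priorMeasure p), Memℓp (AdvHMC.gradZ Φ x) 2)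
    (a : Fin q → ℝ) (ha : ∀ i, 0 < a i) (h : ℝ) (hh : 0 < h) (I : ℕ) :
    -- the energy difference is well defined
    (∀ᵐ w ∂(AdvHMC.jointRef a), Tendsto (fun n : ℕ => AdvHMC.truncDeltaH Φ a h I n w) atTop
      (𝓝 (AdvHMC.deltaH Φ a h I w))) ∧
    -- (i)
    ((AdvHMC.jointTarget Φ a).map (AdvHMC.trajectory Φ a h I) ≪ AdvHMC.jointRef a ∧
      ∃ ρ : AdvHMC.State q × AdvHMC.State q → ENNReal, Measurable ρ ∧
        (AdvHMC.jointTarget Φ a).map (AdvHMC.trajectory Φ a h I) =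
          (AdvHMC.jointRef a).withDensity ρ ∧
        ∀ w, ρ (AdvHMC.trajectory Φ a h I w) =
          (AdvHMC.normConst Φ)⁻¹ * ENNReal.ofReal
            (Real.exp (AdvHMC.deltaH Φ a h I w - Φ (AdvHMC.trajectory Φ a h I w).1))) ∧
    -- (ii)
    (IsProbabilityMeasure (AdvHMC.target Φ) ∧ IsMarkovKernel (AdvHMC.chain Φ a h I) ∧
      (AdvHMC.chain Φ a h I).Invariant (AdvHMC.target Φ)) := by
  obtain ⟨δ, hδ⟩ := AdvHMC.isEnergyShift_trajectory hΦ hdiff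
    ((AdvHMC.refMeasure_absolutelyContinuous_priorMeasure hp hp_pos).ae_le hgrad) ha h I
  have hT := hδ.measurable
  have hS := (AdvHMC.measurePreserving_flipVelocity a).measurable
  have hΔ := AdvHMC.measurable_deltaH hΦ hT
  -- By reversibility, conjugating the trajectory by the flip inverts it. Composing ΔH with this
  -- inverse makes the density a function of the endpoint, defined everywhere.
  let Tinv : AdvHMC.State q × AdvHMC.State q → AdvHMC.State q × AdvHMC.State q := fun w =>
    AdvHMC.flipVelocity (AdvHMC.trajectory Φ a h I (AdvHMC.flipVelocity w))
  have hTinv : ∀ w, Tinv (AdvHMC.trajectory Φ a h I w) = w := fun w => by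
    simp only [Tinv, AdvHMC.trajectory_flipVelocity_trajectory, AdvHMC.flipVelocity_flipVelocity]
  let ρ : AdvHMC.State q × AdvHMC.State q → ENNReal := fun w =>
    (AdvHMC.normConst Φ)⁻¹ *
      ENNReal.ofReal (Real.exp (AdvHMC.deltaH Φ a h I (Tinv w) - Φ w.1))
  have hTm : Measurable Tinv := hS.comp (hT.comp hS)
  have hρ : Measurable ρ := by fun_prop
  have hρT : ∀ w, ρ (AdvHMC.trajectory Φ a h I w) = (AdvHMC.normConst Φ)⁻¹ * ENNReal.ofReal
      (Real.exp (AdvHMC.deltaH Φ a h I w - Φ (AdvHMC.trajectory Φ a h I w).1)) := fun w => by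
    simp only [ρ, hTinv]
  have hmap := AdvHMC.map_jointTarget_trajectory hΦ hδ hρ hρT
  exact ⟨AdvHMC.ae_tendsto_truncDeltaH hδ,
    ⟨hmap ▸ withDensity_absolutelyContinuous _ _, ρ, hρ, hmap, hρT⟩,
    AdvHMC.isProbabilityMeasure_target hΦ hZ, AdvHMC.isMarkovKernel_chain hΦ hT,
    AdvHMC.invariant_chain hΦ hδ⟩
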